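/- Let $G$ be a (not necessarily connected) nilpotent Lie group whose identity component $G^\circ$ is simply connected, and let $\Gamma\subset G$ be a discrete cocompact subgroup such that $X=G/\Gamma$ is connected. Let $G=G_0=G_1\supset G_2\supset\dots\supset G_d\supset G_{d+1}=1$, $G_{i+1}=[G,G_i]$ for $i\ge 1$, be the lower central series of $G$, and assume that every $G_i/\Gamma_i$ is connected, where $\Gamma_i=\Gamma\cap G_i$. Fix a Mal'cev basis of $G/\Gamma$, i.e. elements $e_1,\dots,e_k\in G^\circ$, with one-parameter subgroups $t\mapsto e_j^t$, that are ordered along the lower central series $(G^\circ)_1\supset (G^\circ)_2\supset\cdots$ of $G^\circ$ in such a way that the $e_j$ of level $i$ lie in $(G^\circ)_i$ and their images form a basis of the real vector space $(G^\circ)_i/(G^\circ)_{i+1}$ for each $i\geq 1$, and such that $e_1^{t_1}\cdots e_k^{t_k}\in\Gamma$ if and only if $t_1,\dots,t_k\in\mathbb Z$. For $g\in G$ the fractional part $\{g\}$ is the unique element of the fundamental domain $\{e_1^{t_1}\cdots e_k^{t_k} : 0\le t_j<1\}\subset G^\circ$ with $g\in\{g\}\Gamma$. Let $g\colon\mathbb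 Z\to G$ be a polynomial sequence, i.e. $g(n)=g_0^{\binom n0}g_1^{\binom n1}\cdots g_d^{\binom nd}$ for some $g_i\in G_i$, such that $(g(n)\Gamma)_{n\ge 0}$ is dense in $X$. Suppose that $H\subset G^\circ$ is a closed subgroup (equivalently, an embedded Lie subgroup) such that $\{g(n)\}\in H$ for infinitely many $n\in\mathbb Z$. Then $H=G^\circ$. -/

import Mathlib

open scoped Manifold ContDiff

/-- The lower central series with the indexing `G_0 = G_1 = G`, `G_{i+1} = [G, G_i]` for `i ≥ 1`. -/
def lowerCentral (G : Type*) [Group G] (i : ℕ) : Subgroup G :=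
  (⊤ : Subgroup G).lowerCentralSeries (i - 1)

/-- A sequence `g : ℤ → G` in a nilpotent group is polynomial (with respect to the lower central
series) if `g n = c_0 ^ (n choose 0) * c_1 ^ (n choose 1) * ⋯ * c_d ^ (n choose d)` with
`c_i ∈ G_i`, where `d` is the nilpotency class, so that `G_{d+1} = 1`. The binomial
coefficients are the integers `n (n-1) ⋯ (n-i+1) / i!`, also for negative `n`. -/
def IsPolynomialSequence {G : Type*} [Group G] (g : ℤ → G) : Prop :=
  ∃ c : ℕ → G, (∀ i, c i ∈ lowerCentral G i) ∧
    ∀ n : ℤ, g n =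
      ((List.range (Group.nilpotencyClass G + 1)).map (fun i => c i ^ Ring.choose n i)).prod

/-- The ordered product `e_1 ^ t_1 * ⋯ * e_k ^ t_k`, where `t ↦ e_j ^ t` is the one-parameter
subgroup `φ j`. -/
def orderedProd {N : Type*} [Group N] [TopologicalSpace N] {k : ℕ}
    (φ : Fin k → (Multiplicative ℝ →ₜ* N)) (t : Fin k → ℝ) : N :=
  (List.ofFn (fun j => φ j (Multiplicative.ofAdd (t j)))).prod

/-- A Mal'cev basis of a (connected, simply connected, nilpotent Lie) group `N`, adapted to the
lower central series `N_1 ⊇ N_2 ⊇ ⋯` of `N` and compatible with the (discrete cocompact)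
subgroup `Λ`.
The basis elements are `e_j = φ_j 1`, where `φ_j : ℝ → N`, `t ↦ e_j ^ t`, is the one-parameter
subgroup through `e_j`. They are listed in the order of their levels, and those of level `i`
lie in `N_i` and induce a basis of the real vector space `N_i / N_{i+1}`. -/
structure MalcevBasis (N : Type*) [Group N] [TopologicalSpace N] (Λ : Subgroup N) where
  /-- the number of basis elements -/
  k : ℕ
  /-- the one-parameter subgroups `t ↦ e_j ^ t` through the basis elements `e_j` -/
  φ : Fin k → (Multiplicative ℝ →ₜ* N)
  /-- the level of a basis element -/
  level : Fin k → ℕ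
  one_le_level : ∀ j, 1 ≤ level j
  level_monotone : Monotone level
  mem_level : ∀ j, φ j (Multiplicative.ofAdd 1) ∈ lowerCentral N (level j)
  /-- Every element of `N_i / N_{i+1}` is, in a unique way, the class of a product of real powers
  of the basis elements of level `i`, that is, a linear combination of their classes. -/
  basis_level : ∀ i, 1 ≤ i → ∀ x ∈ lowerCentral N i,
    ∃! t : Fin k → ℝ, (∀ j, level j ≠ i → t j = 0) ∧
      (orderedProd φ t)⁻¹ * x ∈ lowerCentral N (i + 1)
  /-- `e_1 ^ t_1 ⋯ e_k ^ t_k` lies in `Λ` exactly when all coordinates are integers. -/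
  compatible : ∀ t : Fin k → ℝ, orderedProd φ t ∈ Λ ↔ ∀ j, ∃ m : ℤ, t j = m

namespace MalcevBasis

/-- The fundamental domain: all `e_1 ^ t_1 * ⋯ * e_k ^ t_k` with `0 ≤ t_j < 1`. -/
def fundamentalDomain {N : Type*} [Group N] [TopologicalSpace N] {Λ : Subgroup N}
    (B : MalcevBasis N Λ) : Set N :=
  {x | ∃ t : Fin B.k → ℝ, (∀ j, 0 ≤ t j ∧ t j < 1) ∧ x = orderedProd B.φ t}

end MalcevBasis

/-- `x` is the fractional part of `g ∈ G` on the connected nilmanifold `G / Γ`: the element `x` of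
the fundamental domain of the identity component, taken with respect to a Mal'cev basis of the
identity component compatible with its intersection with `Γ`, such that `g = x * γ` with
`γ ∈ Γ` (the integral part of `g`). -/
def IsFractionalPart {G : Type*} [Group G] [TopologicalSpace G] [IsTopologicalGroup G]
    {Γ : Subgroup G}
    (B : MalcevBasis (Subgroup.connectedComponentOfOne G)
      (Γ.subgroupOf (Subgroup.connectedComponentOfOne G)))
    (g x : G) : Prop :=
  (∃ y ∈ B.fundamentalDomain, x = (y : G)) ∧ ∃ γ ∈ Γ, g = x * γ

/-! Write `N` for the identity component. A closed subgroup of a nilpotent group that is dense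
modulo `[N, N]` is everything (`eq_top_of_isClosed_of_dense_mul_commutator`), so it suffices to
study the image of `H` in `N / [N, N] ≅ ℝ^r`, with coordinates `coord`. That image is dense once the
elements of `H` near the identity span `ℝ^r`.

Suppose they do not (`span_coord_eq_top`). Then some nonzero linear form `L` kills their
coordinates, so `L ∘ coord` is locally constant on `H` and takes finitely many values on the part of
`H` in a compact set containing the fundamental domain. By pigeonhole, `L (coord {g n}) = c` for
infinitely many `n`.

Since `Γ` meets every coset of `N`, one can write `g n = v n * γ n` with `v n ∈ N`, `γ n ∈ Γ`.
Conjugation by `G` is unipotent on `ℝ^r`, which allows `coord (v n)` to be polynomial in `n`; it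
agrees with `coord {g n}` modulo `ℤ^r`. A `ℚ`-linear functional `θ : ℝ → ℚ` turns the real relation
into a rational one: a combination of the polynomials with coefficients `θ (L e_i)`, minus a
rational polynomial, is bounded on an infinite set and hence constant
(`exists_int_relation_of_affine_relation`). Clearing denominators gives a nontrivial integer
relation modulo `ℤ` for all `n`, contradicting density in `G / Γ`. -/

open scoped commutatorElement

/-! ### Baire category and continuity of homomorphisms -/

open Topology Set Filter in
/-- A map that becomes continuous after composition with a continuous surjection from a
`σ`-compact space onto a Baire space is continuous somewhere. -/
theorem exists_continuousAt_of_comp_continuous {Y X Z : Type*} [TopologicalSpace Y]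
    [SigmaCompactSpace Y] [TopologicalSpace X] [T2Space X] [BaireSpace X] [Nonempty X]
    [TopologicalSpace Z] {f : Y → X} (hf : Continuous f) (hsurj : Function.Surjective f)
    {p : X → Z} (hp : Continuous (p ∘ f)) : ∃ x, ContinuousAt p x := by
  have hC : ∀ n, IsCompact (f '' compactCovering Y n) := fun n =>
    (isCompact_compactCovering Y n).image hf
  obtain ⟨n, x, hx⟩ := nonempty_interior_of_iUnion_of_closed (fun n => (hC n).isClosed)
    (by rw [← image_iUnion, iUnion_compactCovering, image_univ, hsurj.range_eq])
  refine ⟨x, ContinuousOn.continuousAt (s := f '' compactCovering Y n) ?_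
    (mem_interior_iff_mem_nhds.1 hx)⟩
  rw [continuousOn_iff_isClosed]
  intro t ht
  refine ⟨f '' (compactCovering Y n ∩ (p ∘ f) ⁻¹' t),
    (((isCompact_compactCovering Y n).inter_right (ht.preimage hp)).image hf).isClosed, ?_⟩
  ext y
  constructor
  · rintro ⟨h1, z, hz, rfl⟩
    exact ⟨⟨z, ⟨hz, h1⟩, rfl⟩, z, hz, rfl⟩
  · rintro ⟨⟨z, ⟨hz, h1⟩, rfl⟩, -⟩
    exact ⟨h1, z, hz, rfl⟩

/-- Every element of the commutator subgroup is a finite product of commutators. -/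
theorem exists_prod_commutatorElement {N : Type*} [Group N] {z : N} (hz : z ∈ commutator N) :
    ∃ (n : ℕ) (f : Fin n → N × N), (List.ofFn fun i => ⁅(f i).1, (f i).2⁆).prod = z := by
  rw [commutator_eq_closure, ← Subgroup.mem_toSubmonoid, Subgroup.closure_toSubmonoid] at hz
  obtain ⟨l, hl, rfl⟩ := Submonoid.exists_list_of_mem_closure hz
  have : ∀ x ∈ l, ∃ y : N × N, ⁅y.1, y.2⁆ = x := by
    intro x hx
    rcases hl x hx with ⟨a, b, h⟩ | ⟨a, b, h⟩
    · exact ⟨(a, b), h⟩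
    · exact ⟨(b, a), by rw [← inv_inv x, ← h, commutatorElement_inv]⟩
  choose f hf using this
  refine ⟨l.length, fun i => f (l.get i) (l.get_mem i), ?_⟩
  congr 1
  simp [hf]

open Topology Set Filter in
/-- A homomorphism from a `σ`-compact Baire group to a commutative group is continuous as soon
as it has a continuous section and its kernel is the commutator subgroup. -/
theorem MonoidHom.continuous_of_section {N V : Type*} [Group N] [TopologicalSpace N]
    [IsTopologicalGroup N] [T2Space N] [BaireSpace N] [SigmaCompactSpace N] [CommGroup V]
    [TopologicalSpace V] [IsTopologicalGroup V] [SigmaCompactSpace V] (p : N →* V) (s : V → N)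
    (hs : Continuous s) (hps : ∀ v, p (s v) = v) (hker : p.ker ≤ commutator N) :
    Continuous p := by
  -- The commutator subgroup is not known to be closed, so it is parametrized by tuples of pairs. As
  -- `p` kills commutators, `p ∘ f` is the projection to `V`.
  let f : (Σ n : ℕ, V × (Fin n → N × N)) → N := fun y =>
    s y.2.1 * (List.ofFn fun i => ⁅(y.2.2 i).1, (y.2.2 i).2⁆).prod
  have hf : Continuous f := by
    refine continuous_sigma fun n => ?_
    refine (hs.comp continuous_fst).mul ?_
    simp only [List.ofFn_eq_map]
    refine continuous_list_prod _ fun i _ => ?_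
    simp only [commutatorElement_def]
    fun_prop
  have hcomm : ∀ a b : N, p ⁅a, b⁆ = 1 := fun a b => by
    rw [map_commutatorElement, commutatorElement_eq_one_iff_mul_comm, mul_comm]
  have hpf : ∀ y, p (f y) = y.2.1 := by
    intro y
    simp only [f, map_mul, hps, map_list_prod, List.map_ofFn, Function.comp_def, hcomm]
    simp
  have hsurj : Function.Surjective f := by
    intro x
    obtain ⟨n, g, hg⟩ := exists_prod_commutatorElement (z := (s (p x))⁻¹ * x)
      (hker (by simp [MonoidHom.mem_ker, hps]))
    exact ⟨⟨n, p x, g⟩, by simp [f, hg]⟩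
  obtain ⟨x, hx⟩ := exists_continuousAt_of_comp_continuous hf hsurj (p := p) (by
    have : (p ∘ f) = fun y => y.2.1 := funext hpf
    rw [this]
    exact continuous_sigma fun n => continuous_fst)
  refine continuous_of_continuousAt_one p ?_
  have h1 : ContinuousAt (fun y : N => p (x * y)) 1 :=
    ContinuousAt.comp (g := p) (by simpa using hx) (by fun_prop)
  have h2 : ContinuousAt (fun y : N => (p x)⁻¹ * p (x * y)) 1 := continuousAt_const.mul h1
  simpa using h2

/-! ### Closed subgroups of nilpotent groups -/

open Topology Set Filter in
/-- A closed subgroup of a nilpotent topological group which is dense modulo the commutator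
subgroup is the whole group. -/
theorem eq_top_of_isClosed_of_dense_mul_commutator {N : Type*} [Group N]
    [TopologicalSpace N] [IsTopologicalGroup N] [Group.IsNilpotent N] (H : Subgroup N)
    (hH : IsClosed (H : Set N))
    (hdense : Dense ((H ⊔ commutator N : Subgroup N) : Set N)) : H = ⊤ := by
  -- Descend from `A c = ⊤`, with `c` the nilpotency class, to `A 0 = H`. If `H Z_{i+1}` is dense,
  -- it normalizes `A i` and is central modulo `A i`. Both properties pass to the closure, so `A i`
  -- contains `H` and `[N, N]`, hence is `⊤`.
  let A : ℕ → Subgroup N := fun i => (H ⊔ Subgroup.upperCentralSeries N i).topologicalClosure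
  have hstep : ∀ i, A (i + 1) = ⊤ → A i = ⊤ := by
    intro i hi
    have hAcl : IsClosed (A i : Set N) := Subgroup.isClosed_topologicalClosure _
    have hHA : H ≤ A i := le_sup_left.trans (Subgroup.le_topologicalClosure _)
    have hZA : Subgroup.upperCentralSeries N i ≤ A i :=
      le_sup_right.trans (Subgroup.le_topologicalClosure _)
    have hd : Dense ((H ⊔ Subgroup.upperCentralSeries N (i + 1) : Subgroup N) : Set N) := by
      rw [dense_iff_closure_eq, ← Subgroup.topologicalClosure_coe,
        ← Subgroup.coe_top, ← hi]
    have hcen : ∀ z ∈ Subgroup.upperCentralSeries N (i + 1), ∀ y, ⁅z, y⁆ ∈ A i := fun z hz y =>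
      hZA (by simpa [commutatorElement_def] using
        Subgroup.mem_upperCentralSeries_succ_iff.1 hz y)
    have hnorm1 : H ⊔ Subgroup.upperCentralSeries N (i + 1) ≤
        Subgroup.normalizer (A i : Set N) := by
      refine sup_le (hHA.trans Subgroup.le_normalizer) fun z hz => ?_
      rw [Subgroup.mem_normalizer_iff]
      have key : ∀ z ∈ Subgroup.upperCentralSeries N (i + 1), ∀ a ∈ A i, z * a * z⁻¹ ∈ A i := by
        intro z hz a ha
        have := (A i).mul_mem (hcen z hz a) ha
        simpa [commutatorElement_def] using this
      refine fun a => ⟨key z hz a, fun h => ?_⟩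
      have := key z⁻¹ (inv_mem hz) _ h
      simpa [mul_assoc] using this
    have hconj : ∀ a ∈ A i, ∀ x, x * a * x⁻¹ ∈ A i := by
      intro a ha x
      have hcl : IsClosed {x : N | x * a * x⁻¹ ∈ A i} :=
        hAcl.preimage (f := fun x : N => x * a * x⁻¹) (by fun_prop)
      have hsub : closure _ ⊆ {x : N | x * a * x⁻¹ ∈ A i} := hcl.closure_subset_iff.2
        fun x (hx : x ∈ H ⊔ Subgroup.upperCentralSeries N (i + 1)) =>
          (Subgroup.mem_normalizer_iff.1 (hnorm1 hx) a).1 ha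
      exact hsub (hd.closure_eq ▸ mem_univ x)
    have hN : (A i).Normal := ⟨hconj⟩
    have hmod : ∀ x ∈ H ⊔ Subgroup.upperCentralSeries N (i + 1), ∀ y, ⁅x, y⁆ ∈ A i := by
      have hle : H ⊔ Subgroup.upperCentralSeries N (i + 1) ≤
          (Subgroup.center (N ⧸ A i)).comap (QuotientGroup.mk' (A i)) := by
        have hz : Subgroup.upperCentralSeries N (i + 1) ≤
            (Subgroup.center (N ⧸ A i)).comap (QuotientGroup.mk' (A i)) := by
          intro z hz
          rw [Subgroup.mem_comap, Subgroup.mem_center_iff]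
          intro q
          obtain ⟨y, rfl⟩ := QuotientGroup.mk'_surjective _ q
          have := (QuotientGroup.eq_one_iff _).2 (hcen z hz y)
          have h2 : ⁅QuotientGroup.mk' (A i) z, QuotientGroup.mk' (A i) y⁆ = 1 := by
            rw [← map_commutatorElement]; exact this
          exact (commutatorElement_eq_one_iff_mul_comm.1 h2).symm
        refine sup_le (fun h hh => ?_) hz
        rw [Subgroup.mem_comap, show QuotientGroup.mk' (A i) h = 1 from
          (QuotientGroup.eq_one_iff _).2 (hHA hh)]
        exact one_mem _
      intro x hx y
      have h1 := Subgroup.mem_center_iff.1 (Subgroup.mem_comap.1 (hle hx)) (QuotientGroup.mk' _ y)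
      rw [← QuotientGroup.eq_one_iff]
      change QuotientGroup.mk' (A i) ⁅x, y⁆ = 1
      rw [map_commutatorElement, commutatorElement_eq_one_iff_mul_comm, h1]
    have hcommA : ∀ x y : N, ⁅x, y⁆ ∈ A i := by
      intro x y
      have hcl : IsClosed {x : N | ⁅x, y⁆ ∈ A i} :=
        hAcl.preimage (f := fun x : N => ⁅x, y⁆) (by
          simp only [commutatorElement_def]; fun_prop)
      have hsub : closure _ ⊆ {x : N | ⁅x, y⁆ ∈ A i} := hcl.closure_subset_iff.2
        fun x (hx : x ∈ H ⊔ Subgroup.upperCentralSeries N (i + 1)) => hmod x hx y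
      exact hsub (hd.closure_eq ▸ mem_univ x)
    have hcA : commutator N ≤ A i := by
      rw [commutator_def, Subgroup.commutator_le]
      exact fun x _ y _ => hcommA x y
    rw [eq_top_iff]
    intro x _
    have := (hAcl.closure_subset_iff (s := ((H ⊔ commutator N : Subgroup N) : Set N))).2
      (sup_le hHA hcA)
    exact this (hdense.closure_eq ▸ mem_univ x)
  have hall : ∀ i, A i = ⊤ → A 0 = ⊤ := by
    intro i
    induction i with
    | zero => exact id
    | succ i ih => exact fun h => ih (hstep i h)
  have h0 := hall (Group.nilpotencyClass N) (by
    simp only [A, Subgroup.upperCentralSeries_nilpotencyClass, sup_top_eq]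
    exact top_le_iff.1 (Subgroup.le_topologicalClosure _))
  rw [← h0]
  refine SetLike.coe_injective ?_
  simp only [A, Subgroup.upperCentralSeries_zero, sup_bot_eq, Subgroup.topologicalClosure_coe]
  exact hH.closure_eq.symm

/-! ### Polynomials and rational relations -/

/-- A real polynomial which is bounded on an infinite set of integers is constant. -/
theorem Polynomial.degree_le_zero_of_bounded_on_infinite (p : Polynomial ℝ) {S : Set ℤ}
    (hS : S.Infinite) {M : ℝ} (hM : ∀ n ∈ S, |p.eval (n : ℝ)| ≤ M) : p.degree ≤ 0 := by
  by_contra! h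
  have ht : Filter.Tendsto (fun n : ℤ => ‖p.eval (n : ℝ)‖) Filter.cofinite Filter.atTop := by
    refine p.tendsto_norm_atTop h ?_
    have := tendsto_norm_cocompact_atTop.comp Int.tendsto_coe_cofinite
    exact this
  have hev := ht.eventually_gt_atTop M
  obtain ⟨n, hn, hn'⟩ := ((Filter.frequently_cofinite_iff_infinite.2 hS).and_eventually hev).exists
  exact absurd (hM n hn) (not_le.2 hn')

/-- The map on real polynomials induced by a `ℚ`-linear functional on the coefficients. -/
noncomputable def Polynomial.mapDual (θ : ℝ →ₗ[ℚ] ℚ) (P : Polynomial ℝ) : Polynomial ℚ :=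
  ∑ i ∈ Finset.range (P.natDegree + 1), Polynomial.monomial i (θ (P.coeff i))

theorem Polynomial.eval_mapDual (θ : ℝ →ₗ[ℚ] ℚ) (P : Polynomial ℝ) (q : ℚ) :
    (P.mapDual θ).eval q = θ (P.eval (q : ℝ)) := by
  rw [Polynomial.eval_eq_sum_range (p := P), map_sum, Polynomial.mapDual,
    Polynomial.eval_finsetSum]
  refine Finset.sum_congr rfl fun i _ => ?_
  rw [Polynomial.eval_monomial, mul_comm (P.coeff i), ← Rat.cast_pow, ← Rat.smul_def, map_smul,
    smul_eq_mul, mul_comm]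

/-- If the coordinates of the fractional parts of a polynomial sequence satisfy a fixed affine
relation infinitely often, then the polynomials are rationally dependent modulo the integers. -/
theorem exists_int_relation_of_affine_relation {ι : Type*} [Fintype ι] (p : ι → Polynomial ℝ)
    {S : Set ℤ} (hS : S.Infinite) (m : ℤ → ι → ℤ) {M : ℝ}
    (hM : ∀ n ∈ S, ∀ i, |(p i).eval (n : ℝ) - m n i| ≤ M) (l : ι → ℝ) (hl : l ≠ 0) (c : ℝ)
    (hc : ∀ n ∈ S, ∑ i, l i * ((p i).eval (n : ℝ) - m n i) = c) :
    ∃ q : ι → ℤ, q ≠ 0 ∧ ∃ c' : ℝ, ∀ n : ℤ, ∃ z : ℤ,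
      ∑ i, (q i : ℝ) * (p i).eval (n : ℝ) - c' = z := by
  obtain ⟨i₀, hi₀⟩ := Function.ne_iff.1 hl
  obtain ⟨θ, hθ⟩ : ∃ θ : ℝ →ₗ[ℚ] ℚ, θ (l i₀) ≠ 0 := by
    by_contra! h
    exact hi₀ ((Module.forall_dual_apply_eq_zero_iff ℚ (l i₀)).1 h)
  -- On `S` the relation reads `P n = ∑ m_i l_i`; applying `θ` gives `R n = ∑ θ(l_i) m_i`.
  let P : Polynomial ℝ := ∑ i, Polynomial.C (l i) * p i - Polynomial.C c
  let R : Polynomial ℚ := P.mapDual θ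
  have hR : ∀ n ∈ S, ((R.eval (n : ℚ) : ℚ) : ℝ) = ∑ i, (θ (l i) : ℝ) * m n i := by
    intro n hn
    have h1 : P.eval (((n : ℚ) : ℝ)) = ∑ i, ((m n i : ℚ) • l i) := by
      have h2 := hc n hn
      simp only [mul_sub, Finset.sum_sub_distrib] at h2
      simp only [P, Polynomial.eval_sub, Polynomial.eval_finsetSum, Polynomial.eval_mul,
        Polynomial.eval_C, Rat.smul_def, Rat.cast_intCast]
      simp only [mul_comm ((m n _ : ℤ) : ℝ)]
      linarith
    rw [show R.eval (n : ℚ) = θ (P.eval ((n : ℚ) : ℝ)) from Polynomial.eval_mapDual _ _ _, h1,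
      map_sum, Rat.cast_sum]
    refine Finset.sum_congr rfl fun i _ => ?_
    rw [map_smul, smul_eq_mul, mul_comm, Rat.cast_mul, Rat.cast_intCast]
  -- On `S` this equals `∑ θ(l_i) (p_i - m_i)`, which is bounded.
  let Q : Polynomial ℝ := ∑ i, Polynomial.C ((θ (l i) : ℚ) : ℝ) * p i -
    R.map (algebraMap ℚ ℝ)
  have hQeval : ∀ n : ℤ, Q.eval (n : ℝ) =
      ∑ i, (θ (l i) : ℝ) * (p i).eval (n : ℝ) - ((R.eval (n : ℚ) : ℚ) : ℝ) := by
    intro n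
    have : (R.map (algebraMap ℚ ℝ)).eval (n : ℝ) = ((R.eval (n : ℚ) : ℚ) : ℝ) := by
      have := Polynomial.eval_map_algebraMap (B := ℝ) R (n : ℝ)
      have h3 := Polynomial.aeval_algebraMap_apply (A := ℚ) ℝ (n : ℚ) R
      rw [this]
      simpa using h3
    simp only [Q, Polynomial.eval_sub, Polynomial.eval_finsetSum, Polynomial.eval_mul,
      Polynomial.eval_C, this]
  have hQ : Q.degree ≤ 0 := by
    refine Q.degree_le_zero_of_bounded_on_infinite hS (M := ∑ i, |(θ (l i) : ℝ)| * M) ?_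
    intro n hn
    rw [hQeval, hR n hn, ← Finset.sum_sub_distrib]
    refine (Finset.abs_sum_le_sum_abs _ _).trans (Finset.sum_le_sum fun i _ => ?_)
    rw [← mul_sub, abs_mul]
    exact mul_le_mul_of_nonneg_left (hM n hn i) (abs_nonneg _)
  have hconst : ∀ n : ℤ, ∑ i, (θ (l i) : ℝ) * (p i).eval (n : ℝ) =
      Q.coeff 0 + ((R.eval (n : ℚ) : ℚ) : ℝ) := by
    intro n
    have h1 := hQeval n
    rw [Polynomial.eq_C_of_degree_le_zero hQ, Polynomial.eval_C] at h1
    linarith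
  -- `b` clears the denominators of `R`, and `b'` those of the `θ(l_i)`.
  obtain ⟨b, hb, hbR⟩ := IsLocalization.integerNormalization_spec (nonZeroDivisors ℤ) R
  obtain ⟨⟨b', hb'⟩, hbl⟩ := IsLocalization.exist_integer_multiples_of_finite
    (nonZeroDivisors ℤ) (fun i => θ (l i))
  choose q hq using hbl
  simp only [eq_intCast, zsmul_eq_mul] at hq
  have hb0 := nonZeroDivisors.ne_zero hb
  have hb0' := nonZeroDivisors.ne_zero hb'
  have hRint : ∀ n : ℤ, ((b : ℤ) : ℚ) * R.eval (n : ℚ) =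
      (((IsLocalization.integerNormalization (nonZeroDivisors ℤ) R).eval n : ℤ) : ℚ) := by
    intro n
    have h1 := congrArg (Polynomial.eval (n : ℚ)) hbR
    rw [Polynomial.eval_smul, zsmul_eq_mul] at h1
    rw [← h1]
    simp
  refine ⟨fun i => b * q i, fun h => ?_, b * b' * Q.coeff 0, fun n =>
    ⟨b' * (IsLocalization.integerNormalization (nonZeroDivisors ℤ) R).eval n, ?_⟩⟩
  · have h1 : b * q i₀ = 0 := congrFun h i₀
    have h2 : q i₀ = 0 := (mul_eq_zero.1 h1).resolve_left hb0
    have h3 := hq i₀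
    rw [h2, Int.cast_zero] at h3
    exact (mul_ne_zero (Int.cast_ne_zero.2 hb0') hθ) h3.symm
  · have h1 : ∀ i, (q i : ℝ) = b' * (θ (l i) : ℝ) := fun i => by exact_mod_cast hq i
    have h2 : ((b : ℤ) : ℝ) * ((R.eval (n : ℚ) : ℚ) : ℝ) =
      (((IsLocalization.integerNormalization (nonZeroDivisors ℤ) R).eval n : ℤ) : ℝ) := by
      exact_mod_cast hRint n
    push_cast
    rw [← h2]
    simp only [h1]
    have h3 : ∑ i, (b : ℝ) * (b' * (θ (l i) : ℝ)) * (p i).eval (n : ℝ) =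
        b * b' * ∑ i, (θ (l i) : ℝ) * (p i).eval (n : ℝ) := by
      rw [Finset.mul_sum]
      exact Finset.sum_congr rfl fun i _ => by ring
    rw [h3, hconst]
    ring

/-! ### Ordered products and first-level coordinates -/

theorem lowerCentral_two (N : Type*) [Group N] : lowerCentral N 2 = commutator N :=
  Subgroup.top_lowerCentralSeries_one

theorem continuous_orderedProd {N : Type*} [Group N] [TopologicalSpace N] [IsTopologicalGroup N]
    {k : ℕ} (φ : Fin k → (Multiplicative ℝ →ₜ* N)) : Continuous (orderedProd φ) := by
  unfold orderedProd
  simp only [List.ofFn_eq_map]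
  refine continuous_list_prod _ fun j _ => (φ j).continuous_toFun.comp ?_
  exact continuous_ofAdd.comp (continuous_apply j)

theorem orderedProd_zero {N : Type*} [Group N] [TopologicalSpace N] {k : ℕ}
    (φ : Fin k → (Multiplicative ℝ →ₜ* N)) : orderedProd φ 0 = 1 := by
  simp [orderedProd]

theorem orderedProd_succ {N : Type*} [Group N] [TopologicalSpace N] {k : ℕ}
    (φ : Fin (k + 1) → (Multiplicative ℝ →ₜ* N)) (t : Fin (k + 1) → ℝ) :
    orderedProd φ t =
      φ 0 (Multiplicative.ofAdd (t 0)) * orderedProd (Fin.tail φ) (Fin.tail t) := by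
  simp [orderedProd, Fin.tail, List.ofFn_succ]

/-- Ordered products can be concatenated when the supports are separated by a level. -/
theorem orderedProd_add_of_level {N : Type*} [Group N] [TopologicalSpace N] {k : ℕ}
    (φ : Fin k → (Multiplicative ℝ →ₜ* N)) (level : Fin k → ℕ) (hlevel : Monotone level) (i : ℕ)
    (t s : Fin k → ℝ) (ht : ∀ j, i < level j → t j = 0) (hs : ∀ j, level j ≤ i → s j = 0) :
    orderedProd φ (t + s) = orderedProd φ t * orderedProd φ s := by
  induction k with
  | zero => simp [orderedProd]
  | succ k ih =>
    by_cases h0 : i < level 0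
    · have : t = 0 := funext fun j => ht j (h0.trans_le (hlevel (Fin.zero_le j)))
      rw [this, orderedProd_zero, zero_add, one_mul]
    · have hs0 := hs 0 (not_lt.1 h0)
      have htail := ih (Fin.tail φ) (Fin.tail level)
        (fun a b hab => hlevel (Fin.succ_le_succ_iff.2 hab)) (Fin.tail t) (Fin.tail s)
        (fun j => ht j.succ) (fun j => hs j.succ)
      rw [orderedProd_succ φ t, orderedProd_succ φ s, orderedProd_succ φ (t + s), Pi.add_apply,
        hs0, add_zero, show Fin.tail (t + s) = Fin.tail t + Fin.tail s from rfl, htail,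
        ofAdd_zero, map_one, one_mul, mul_assoc]

theorem abelianization_of_orderedProd {N : Type*} [Group N] [TopologicalSpace N] {k : ℕ}
    (φ : Fin k → (Multiplicative ℝ →ₜ* N)) (t : Fin k → ℝ) :
    Abelianization.of (orderedProd φ t) =
      ∏ j, Abelianization.of (φ j (Multiplicative.ofAdd (t j))) := by
  rw [orderedProd, map_list_prod, List.map_ofFn, List.prod_ofFn]
  rfl

theorem abelianization_of_orderedProd_add {N : Type*} [Group N] [TopologicalSpace N] {k : ℕ}
    (φ : Fin k → (Multiplicative ℝ →ₜ* N)) (t s : Fin k → ℝ) :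
    Abelianization.of (orderedProd φ (t + s)) =
      Abelianization.of (orderedProd φ t) * Abelianization.of (orderedProd φ s) := by
  simp only [abelianization_of_orderedProd, ← Finset.prod_mul_distrib, ← map_mul, ← ofAdd_add,
    Pi.add_apply]

theorem abelianization_of_eq_iff {N : Type*} [Group N] {x y : N} :
    Abelianization.of x = Abelianization.of y ↔ x⁻¹ * y ∈ commutator N := by
  rw [← Abelianization.ker_of, MonoidHom.mem_ker, map_mul, map_inv, inv_mul_eq_one]

namespace MalcevBasis

variable {N : Type*} [Group N] [TopologicalSpace N] {Λ : Subgroup N} (B : MalcevBasis N Λ)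

/-- The indices of the basis elements of the first level. -/
abbrev FirstLevel : Type := {j : Fin B.k // B.level j = 1}

/-- Extension by zero of first-level coordinates. -/
def extend (v : B.FirstLevel → ℝ) (j : Fin B.k) : ℝ :=
  if h : B.level j = 1 then v ⟨j, h⟩ else 0

theorem extend_add (v w : B.FirstLevel → ℝ) : B.extend (v + w) = B.extend v + B.extend w := by
  ext j
  by_cases h : B.level j = 1 <;> simp [extend, h]

/-- The ordered products of real powers of the first-level basis elements. -/
def firstLevelProd (v : B.FirstLevel → ℝ) : N := orderedProd B.φ (B.extend v)

theorem continuous_firstLevelProd [IsTopologicalGroup N] : Continuous B.firstLevelProd := by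
  refine (continuous_orderedProd B.φ).comp (continuous_pi fun j => ?_)
  by_cases h : B.level j = 1
  · simpa [extend, h] using continuous_apply _
  · simpa [extend, h] using continuous_const

theorem existsUnique_firstLevel (x : N) : ∃! v : B.FirstLevel → ℝ,
    Abelianization.of (B.firstLevelProd v) = Abelianization.of x := by
  obtain ⟨t, ⟨ht, htx⟩, huniq⟩ := B.basis_level 1 le_rfl x (Subgroup.mem_top x)
  refine ⟨fun j => t j, ?_, fun w hw => ?_⟩
  · have : B.extend (fun j => t j) = t := by
      ext j
      by_cases h : B.level j = 1
      · simp [extend, h]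
      · simp [extend, h, ht j h]
    simp only [firstLevelProd, this]
    rw [abelianization_of_eq_iff, ← lowerCentral_two]
    exact htx
  · have := huniq (B.extend w) ⟨fun j hj => by simp [extend, hj], by
      change _ ∈ lowerCentral N 2
      rw [lowerCentral_two, ← abelianization_of_eq_iff]
      exact hw⟩
    ext j
    rw [← this]
    simp [extend, j.2]

/-- The first-level coordinates. -/
noncomputable def coord (x : N) : B.FirstLevel → ℝ := (B.existsUnique_firstLevel x).choose

theorem of_firstLevelProd_coord (x : N) :
    Abelianization.of (B.firstLevelProd (B.coord x)) = Abelianization.of x :=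
  (B.existsUnique_firstLevel x).choose_spec.1

theorem coord_eq {x : N} {v : B.FirstLevel → ℝ}
    (h : Abelianization.of (B.firstLevelProd v) = Abelianization.of x) : B.coord x = v :=
  ((B.existsUnique_firstLevel x).choose_spec.2 v h).symm

theorem coord_firstLevelProd (v : B.FirstLevel → ℝ) : B.coord (B.firstLevelProd v) = v :=
  B.coord_eq rfl

theorem coord_surjective : Function.Surjective B.coord :=
  fun v => ⟨_, B.coord_firstLevelProd v⟩

theorem coord_mul (x y : N) : B.coord (x * y) = B.coord x + B.coord y := by
  refine B.coord_eq ?_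
  rw [firstLevelProd, extend_add, abelianization_of_orderedProd_add, map_mul,
    ← B.of_firstLevelProd_coord x, ← B.of_firstLevelProd_coord y]
  rfl

/-- The first-level coordinates as a homomorphism. -/
noncomputable def coordHom : N →* Multiplicative (B.FirstLevel → ℝ) :=
  MonoidHom.mk' (fun x => Multiplicative.ofAdd (B.coord x)) fun x y => by
    rw [coord_mul, ofAdd_add]

theorem coord_one : B.coord 1 = 0 := congrArg Multiplicative.toAdd (map_one B.coordHom)

theorem coord_inv (x : N) : B.coord x⁻¹ = -B.coord x :=
  congrArg Multiplicative.toAdd (map_inv B.coordHom x)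

theorem coord_eq_zero_iff {x : N} : B.coord x = 0 ↔ x ∈ commutator N := by
  rw [← Abelianization.ker_of, MonoidHom.mem_ker]
  have h1 : B.firstLevelProd 0 = 1 := by
    rw [firstLevelProd, show B.extend 0 = 0 from funext fun j => by simp [extend],
      orderedProd_zero]
  constructor
  · intro h
    rw [← B.of_firstLevelProd_coord x, h, h1, map_one]
  · intro h
    refine B.coord_eq ?_
    rw [h, h1, map_one]

/-- Peel off the coordinates of level `i` and continue with the remainder in `N_{i+1}`; `n` bounds
the number of levels left before the series is trivial. -/
theorem exists_orderedProd_eq_of_mem_lowerCentral [Group.IsNilpotent N] (n : ℕ) :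
    ∀ i, 1 ≤ i → Group.nilpotencyClass N + 1 ≤ n + i → ∀ x ∈ lowerCentral N i,
      ∃ t : Fin B.k → ℝ, (∀ j, B.level j < i → t j = 0) ∧ orderedProd B.φ t = x := by
  induction n with
  | zero =>
    intro i hi hn x hx
    refine ⟨0, fun _ _ => rfl, ?_⟩
    have : x ∈ (⊥ : Subgroup N) := by
      rw [← Subgroup.lowerCentralSeries_nilpotencyClass]
      exact Subgroup.lowerCentralSeries_antitone _ (by omega) hx
    rw [orderedProd_zero, Subgroup.mem_bot.1 this]
  | succ n ih =>
    intro i hi hn x hx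
    obtain ⟨t, ⟨ht, htx⟩, -⟩ := B.basis_level i hi x hx
    obtain ⟨s, hs, hsx⟩ := ih (i + 1) (by omega) (by omega) _ htx
    refine ⟨t + s, fun j hj => ?_, ?_⟩
    · rw [Pi.add_apply, ht j hj.ne, hs j (by omega), add_zero]
    · rw [orderedProd_add_of_level B.φ B.level B.level_monotone i t s
        (fun j hj => ht j hj.ne') (fun j hj => hs j (by omega)), hsx, mul_inv_cancel_left]

theorem orderedProd_surjective [Group.IsNilpotent N] :
    Function.Surjective (orderedProd B.φ) := fun x => by
  obtain ⟨t, -, h⟩ := B.exists_orderedProd_eq_of_mem_lowerCentral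
    (Group.nilpotencyClass N) 1 le_rfl le_rfl x (Subgroup.mem_top x)
  exact ⟨t, h⟩

/-- The lattice elements have integer first-level coordinates. -/
theorem exists_int_coord [Group.IsNilpotent N] {x : N} (hx : x ∈ Λ) :
    ∃ m : B.FirstLevel → ℤ, B.coord x = fun i => (m i : ℝ) := by
  obtain ⟨t, rfl⟩ := B.orderedProd_surjective x
  choose m hm using (B.compatible t).1 hx
  refine ⟨fun i => m i, B.coord_eq ?_⟩
  rw [firstLevelProd, abelianization_of_orderedProd, abelianization_of_orderedProd]
  refine Finset.prod_congr rfl fun j _ => ?_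
  by_cases h : B.level j = 1
  · simp [extend, h, hm]
  -- Only `e_j`, not its real powers, is given to lie in `N_2`; integrality of `t j` makes this
  -- enough.
  · have h2 : B.φ j (Multiplicative.ofAdd 1) ∈ commutator N := by
      rw [← lowerCentral_two]
      refine Subgroup.lowerCentralSeries_antitone _ ?_ (B.mem_level j)
      have := B.one_le_level j
      omega
    have h3 : B.φ j (Multiplicative.ofAdd (t j)) = B.φ j (Multiplicative.ofAdd 1) ^ m j := by
      rw [← map_zpow, ← ofAdd_zsmul, hm j, zsmul_one]
    rw [← Abelianization.ker_of, MonoidHom.mem_ker] at h2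
    rw [h3, map_zpow, h2, one_zpow]
    simp [extend, h]

theorem sigmaCompactSpace (B : MalcevBasis N Λ) [IsTopologicalGroup N] [Group.IsNilpotent N] : SigmaCompactSpace N := by
  rw [← isSigmaCompact_univ_iff, ← B.orderedProd_surjective.range_eq]
  exact isSigmaCompact_range (continuous_orderedProd B.φ)

theorem continuous_coord [IsTopologicalGroup N] [T2Space N] [LocallyCompactSpace N]
    [Group.IsNilpotent N] : Continuous B.coord := by
  have := B.sigmaCompactSpace
  have : SigmaCompactSpace (Multiplicative (B.FirstLevel → ℝ)) :=
    inferInstanceAs (SigmaCompactSpace (B.FirstLevel → ℝ))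
  have h : Continuous B.coordHom := B.coordHom.continuous_of_section
    (fun v => B.firstLevelProd (Multiplicative.toAdd v))
    (B.continuous_firstLevelProd.comp continuous_toAdd)
    (fun v => congrArg Multiplicative.ofAdd (B.coord_firstLevelProd _))
    (fun x hx => B.coord_eq_zero_iff.1 (congrArg Multiplicative.toAdd (MonoidHom.mem_ker.1 hx)))
  exact continuous_toAdd.comp h

theorem exists_isCompact_fundamentalDomain_subset [IsTopologicalGroup N] :
    ∃ K : Set N, IsCompact K ∧ B.fundamentalDomain ⊆ K := by
  refine ⟨orderedProd B.φ '' Set.univ.pi fun _ => Set.Icc 0 1,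
    (isCompact_univ_pi fun _ => isCompact_Icc).image (continuous_orderedProd B.φ), ?_⟩
  rintro _ ⟨t, ht, rfl⟩
  exact ⟨t, fun j _ => ⟨(ht j).1, (ht j).2.le⟩, rfl⟩

/-- The commutator subgroup is characteristic, so `α` descends to the coordinates. -/
theorem coord_apply_eq_of_coord_eq (α : N ≃* N) {x y : N} (h : B.coord x = B.coord y) :
    B.coord (α x) = B.coord (α y) := by
  have h1 : x⁻¹ * y ∈ commutator N := by
    rw [← B.coord_eq_zero_iff, coord_mul, coord_inv, h, neg_add_cancel]
  have h2 : α (x⁻¹ * y) ∈ commutator N :=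
    (Subgroup.characteristic_iff_map_le.1 inferInstance α) (Subgroup.mem_map_of_mem _ h1)
  rw [← B.coord_eq_zero_iff, map_mul, map_inv, coord_mul, coord_inv] at h2
  exact (neg_add_eq_zero.1 h2)

variable [IsTopologicalGroup N] [T2Space N] [LocallyCompactSpace N] [Group.IsNilpotent N]

/-- The linear map induced on the first-level coordinates by an automorphism. -/
noncomputable def coordMap (α : N ≃* N) (hα : Continuous α) :
    (B.FirstLevel → ℝ) →L[ℝ] (B.FirstLevel → ℝ) :=
  AddMonoidHom.toRealLinearMap
    (AddMonoidHom.mk' (fun v => B.coord (α (B.firstLevelProd v))) fun v w => by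
      rw [← coord_mul, ← map_mul]
      refine B.coord_apply_eq_of_coord_eq α ?_
      simp only [coord_mul, coord_firstLevelProd])
    (B.continuous_coord.comp (hα.comp B.continuous_firstLevelProd))

theorem coordMap_coord (α : N ≃* N) (hα : Continuous α) (x : N) :
    B.coordMap α hα (B.coord x) = B.coord (α x) :=
  B.coord_apply_eq_of_coord_eq α (B.coord_firstLevelProd _)

end MalcevBasis

/-! ### Polynomial functions and unipotent recurrences -/

/-- Functions `ℤ → ℝ^ι` all of whose coordinates are polynomials. -/
def IsPolyFun {ι : Type*} (f : ℤ → ι → ℝ) : Prop :=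
  ∃ p : ι → Polynomial ℝ, ∀ n i, f n i = (p i).eval (n : ℝ)

namespace IsPolyFun

variable {ι : Type*}

theorem zero : IsPolyFun (fun _ => (0 : ι → ℝ)) := ⟨fun _ => 0, by simp⟩

theorem const (w : ι → ℝ) : IsPolyFun (fun _ => w) := ⟨fun i => Polynomial.C (w i), by simp⟩

theorem add {f g : ℤ → ι → ℝ} (hf : IsPolyFun f) (hg : IsPolyFun g) :
    IsPolyFun (fun n => f n + g n) := by
  obtain ⟨p, hp⟩ := hf
  obtain ⟨q, hq⟩ := hg
  exact ⟨fun i => p i + q i, fun n i => by simp [hp, hq]⟩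

theorem smul {a : ℤ → ℝ} (q : Polynomial ℝ) (ha : ∀ n : ℤ, a n = q.eval (n : ℝ))
    {f : ℤ → ι → ℝ} (hf : IsPolyFun f) : IsPolyFun (fun n => a n • f n) := by
  obtain ⟨p, hp⟩ := hf
  exact ⟨fun i => q * p i, fun n i => by simp [hp, ha]⟩

theorem sum {κ : Type*} (s : Finset κ) {f : κ → ℤ → ι → ℝ} (hf : ∀ k ∈ s, IsPolyFun (f k)) :
    IsPolyFun (fun n => ∑ k ∈ s, f k n) := by
  classical
  induction s using Finset.induction_on with
  | empty => simpa using zero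
  | insert a s ha ih =>
    simp only [Finset.sum_insert ha]
    exact (hf a (Finset.mem_insert_self _ _)).add
      (ih fun k hk => hf k (Finset.mem_insert_of_mem hk))

theorem comp {f : ℤ → ι → ℝ} (hf : IsPolyFun f) {h : ℤ → ℤ} (q : Polynomial ℝ)
    (hq : ∀ n : ℤ, (h n : ℝ) = q.eval (n : ℝ)) : IsPolyFun (fun n => f (h n)) := by
  obtain ⟨p, hp⟩ := hf
  exact ⟨fun i => (p i).comp q, fun n i => by simp [hp, hq]⟩

/-- A polynomial family of linear maps applied to a polynomial function is polynomial. -/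
theorem apply [Fintype ι] {T : ℤ → (ι → ℝ) →L[ℝ] (ι → ℝ)} (hT : ∀ w, IsPolyFun (fun n => T n w))
    {f : ℤ → ι → ℝ} (hf : IsPolyFun f) : IsPolyFun (fun n => T n (f n)) := by
  classical
  obtain ⟨p, hp⟩ := hf
  have : (fun n => T n (f n)) = fun n => ∑ i, f n i • T n (Pi.single i 1) := by
    ext1 n
    conv_lhs => rw [pi_eq_sum_univ' (f n)]
    rw [map_sum]
    refine Finset.sum_congr rfl fun i _ => ?_
    rw [map_smul]
  rw [this]
  exact sum _ fun i _ => smul (p i) (fun n => hp n i) (hT _)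

end IsPolyFun

theorem exists_polynomial_eval_eq_choose (i : ℕ) :
    ∃ q : Polynomial ℝ, ∀ n : ℤ, ((Ring.choose n i : ℤ) : ℝ) = q.eval (n : ℝ) := by
  refine ⟨Polynomial.C ((i.factorial : ℝ)⁻¹) * descPochhammer ℝ i, fun n => ?_⟩
  have h := congrArg (Int.cast (R := ℝ)) (Ring.descPochhammer_eq_factorial_smul_choose n i)
  rw [Polynomial.eval_mul, Polynomial.eval_C, eq_inv_mul_iff_mul_eq₀ (by positivity)]
  rw [nsmul_eq_mul, Int.cast_mul, Int.cast_natCast] at h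
  rw [← h, ← Polynomial.eval_eq_smeval]
  have := descPochhammer_map (Int.castRingHom ℝ) i
  rw [← this, Polynomial.eval_intCast_map]
  simp

/-- Linear combinations of binomial coefficient functions. -/
def IsBinomialSum {V : Type*} [AddCommGroup V] (f : ℤ → V) : Prop :=
  ∃ (r : ℕ) (w : ℕ → V), ∀ m : ℤ, f m = ∑ j ∈ Finset.range r, Ring.choose m j • w j

/-- By Pascal's rule, summation shifts the coefficients by one and adds the constant `f 0`. -/
theorem IsBinomialSum.of_fwdDiff {V : Type*} [AddCommGroup V] {f : ℤ → V}
    (h : IsBinomialSum fun m => f (m + 1) - f m) : IsBinomialSum f := by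
  obtain ⟨r, w, hw⟩ := h
  change ∀ m, f (m + 1) - f m = _ at hw
  refine ⟨r + 1, fun j => Nat.casesOn j (f 0) w, ?_⟩
  let F : ℤ → V := fun m => ∑ j ∈ Finset.range (r + 1),
    Ring.choose m j • (Nat.casesOn j (f 0) w : V)
  have hF : ∀ m, F (m + 1) - F m = f (m + 1) - f m := by
    intro m
    rw [hw m]
    simp only [F, Finset.sum_range_succ', Ring.choose_succ_succ, Ring.choose_zero_right]
    simp [add_smul, Finset.sum_add_distrib]
  have h0 : F 0 = f 0 := by
    simp only [F, Finset.sum_range_succ']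
    rw [Finset.sum_eq_zero]
    · simp
    · intro j _
      simp [Ring.choose_zero_succ]
  intro m
  change f m = F m
  induction m using Int.induction_on with
  | zero => exact h0.symm
  | succ i ih =>
    have := hF i
    rw [ih] at this
    exact (sub_left_injective this).symm
  | pred i ih =>
    have := hF (-(i : ℤ) - 1)
    rw [sub_add_cancel, ih] at this
    exact (sub_right_injective this).symm

theorem IsBinomialSum.isPolyFun {ι : Type*} {f : ℤ → ι → ℝ} (h : IsBinomialSum f) :
    IsPolyFun f := by
  obtain ⟨r, w, hw⟩ := h
  have : f = fun m => ∑ j ∈ Finset.range r, ((Ring.choose m j : ℤ) : ℝ) • w j := by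
    ext1 m
    simp only [hw, Int.cast_smul_eq_zsmul]
  rw [this]
  refine IsPolyFun.sum _ fun j _ => ?_
  obtain ⟨q, hq⟩ := exists_polynomial_eval_eq_choose j
  exact IsPolyFun.smul q hq (IsPolyFun.const _)

/-- The forward difference of `f` is `(T - 1) f`, which is killed by one power of `T - 1` less. -/
theorem isBinomialSum_of_linear_recurrence {V : Type*} [AddCommGroup V] [Module ℝ V]
    (T : V →ₗ[ℝ] V) (r : ℕ) : ∀ f : ℤ → V, (∀ m, f (m + 1) = T (f m)) →
      (∀ m, ((T - 1) ^ r) (f m) = 0) → IsBinomialSum f := by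
  induction r with
  | zero => exact fun f _ h => ⟨0, 0, fun m => by simpa using h m⟩
  | succ r ih =>
    intro f hf h
    refine IsBinomialSum.of_fwdDiff (ih _ (fun m => ?_) fun m => ?_)
    · rw [map_sub, ← hf, ← hf]
    · rw [hf]
      simpa [pow_succ] using h m

/-- The orbits of a unipotent affine map are polynomial. -/
theorem isPolyFun_of_affine_recurrence {ι : Type*} (T : (ι → ℝ) →ₗ[ℝ] (ι → ℝ)) {r : ℕ}
    (hT : (T - 1) ^ r = 0) (b : ι → ℝ) {f : ℤ → ι → ℝ} (hf : ∀ m, f (m + 1) = T (f m) + b) :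
    IsPolyFun f := by
  -- Passing to increments removes the translation `b`.
  refine (IsBinomialSum.of_fwdDiff
    (isBinomialSum_of_linear_recurrence T r _ (fun m => ?_) fun m => ?_)).isPolyFun
  · rw [map_sub, hf (m + 1), hf m, add_sub_add_right_eq_sub, ← map_sub]
  · rw [hT]
    rfl

/-! ### Density, conjugation and polynomial decompositions -/

theorem continuous_conjNormal {G : Type*} [Group G] [TopologicalSpace G] [IsTopologicalGroup G]
    {N : Subgroup G} [N.Normal] (g : G) : Continuous (MulAut.conjNormal g : N ≃* N) :=
  Continuous.subtype_mk (f := fun x : N => g * x * g⁻¹) (by fun_prop) _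

/-- A sequence with dense image in `G / Γ` satisfies no rational relation modulo the integers. -/
theorem not_int_relation_of_dense {G : Type*} [Group G] [TopologicalSpace G]
    [IsTopologicalGroup G] [Group.IsNilpotent G] {N : Subgroup G} [T2Space N]
    [LocallyCompactSpace N] {Γ : Subgroup G} (B : MalcevBasis N (Γ.subgroupOf N))
    (hNopen : IsOpen (N : Set G)) {g : ℤ → G}
    (hdense : Dense (Set.range (fun n : ℕ => (QuotientGroup.mk (g (n : ℤ)) : G ⧸ Γ))))
    {v : ℤ → N} {γ : ℤ → G} (hγ : ∀ n, γ n ∈ Γ) (hg : ∀ n, g n = v n * γ n)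
    (q : B.FirstLevel → ℤ) (hq : q ≠ 0) (c : ℝ) :
    ¬ ∀ n : ℤ, ∃ z : ℤ, ∑ i, (q i : ℝ) * B.coord (v n) i - c = z := by
  classical
  intro h
  let F : N → ℝ := fun x => ∑ i, (q i : ℝ) * B.coord x i - c
  have hF : Continuous F := by
    have := B.continuous_coord
    fun_prop
  -- Right translation by the lattice changes `F` by an integer, so the open condition `F ∉ ℤ`
  -- depends only on the coset; density yields some `v n` satisfying it.
  have hFmul : ∀ x y : N, F (x * y) = F x + ∑ i, (q i : ℝ) * B.coord y i := by
    intro x y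
    simp only [F, B.coord_mul, Pi.add_apply, mul_add, Finset.sum_add_distrib]
    ring
  let A : Set N := {x | F x ∉ Set.range ((↑) : ℤ → ℝ)}
  have hA : IsOpen A := (Int.isClosedEmbedding_coe_real.isClosed_range.isOpen_compl).preimage hF
  obtain ⟨i₀, hi₀⟩ := Function.ne_iff.1 hq
  have hi₀' : (q i₀ : ℝ) ≠ 0 := Int.cast_ne_zero.2 hi₀
  have hAne : A.Nonempty := by
    -- Chosen so that `F = 1/2`.
    refine ⟨B.firstLevelProd (Pi.single i₀ ((c + 1 / 2) / q i₀)), ?_⟩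
    rintro ⟨z, hz⟩
    simp only [F, B.coord_firstLevelProd] at hz
    rw [Finset.sum_eq_single i₀ (fun j _ hj => by simp [hj]) (by simp), Pi.single_eq_same,
      mul_div_cancel₀ _ hi₀'] at hz
    have h2 : (2 * z : ℝ) = 1 := by linarith
    have h3 : 2 * z = 1 := by exact_mod_cast h2
    omega
  have hA' : IsOpen ((QuotientGroup.mk : G → G ⧸ Γ) '' (Subtype.val '' A)) :=
    QuotientGroup.isOpenMap_coe _ (hNopen.isOpenMap_subtype_val _ hA)
  obtain ⟨_, ⟨_, ⟨a, ha, rfl⟩, hag⟩, n, rfl⟩ :=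
    hdense.inter_open_nonempty _ hA' ((hAne.image _).image _)
  have h1 : (a : G)⁻¹ * g n ∈ Γ := QuotientGroup.eq.1 hag
  have h2 : (a : G)⁻¹ * v n ∈ Γ := by
    rw [hg, ← mul_assoc] at h1
    exact (Subgroup.mul_mem_cancel_right _ (hγ n)).1 h1
  obtain ⟨m, hm⟩ := B.exists_int_coord (x := a⁻¹ * v n) (Subgroup.mem_subgroupOf.2 h2)
  obtain ⟨z, hz⟩ := h n
  refine ha ⟨z - ∑ i, q i * m i, ?_⟩
  have h3 := hFmul a (a⁻¹ * v n)
  rw [mul_inv_cancel_left, hm] at h3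
  change F (v n) = z at hz
  push_cast
  linarith

section Nilmanifold

variable {G : Type*} [Group G] [TopologicalSpace G] [IsTopologicalGroup G] [Group.IsNilpotent G]
  {N : Subgroup G} [N.Normal] [T2Space N] [LocallyCompactSpace N] {Γ : Subgroup G}
  (B : MalcevBasis N (Γ.subgroupOf N))

/-- The action of `G` by conjugation on the first-level coordinates of a normal subgroup. -/
noncomputable def conjMap (g : G) : (B.FirstLevel → ℝ) →L[ℝ] (B.FirstLevel → ℝ) :=
  B.coordMap (MulAut.conjNormal g) (continuous_conjNormal g)

theorem conjMap_coord (g : G) (x : N) :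
    conjMap B g (B.coord x) = B.coord (MulAut.conjNormal g x) :=
  B.coordMap_coord _ _ x

theorem conjMap_mul (g h : G) (w : B.FirstLevel → ℝ) :
    conjMap B (g * h) w = conjMap B g (conjMap B h w) := by
  obtain ⟨x, rfl⟩ := B.coord_surjective w
  simp only [conjMap_coord, map_mul, MulAut.mul_apply]

/-- `conjMap B g - 1` sends `coord y` to `coord (g y g⁻¹ y⁻¹)`, so each application goes one step
down the lower central series of `G`. -/
theorem conjMap_unipotent (g : G) :
    ((conjMap B g : (B.FirstLevel → ℝ) →ₗ[ℝ] (B.FirstLevel → ℝ)) - 1) ^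
      Group.nilpotencyClass G = 0 := by
  have key : ∀ (r : ℕ) (x : N), ∃ y : N,
      (y : G) ∈ (⊤ : Subgroup G).lowerCentralSeries r ∧
      (((conjMap B g : (B.FirstLevel → ℝ) →ₗ[ℝ] (B.FirstLevel → ℝ)) - 1) ^ r) (B.coord x) =
        B.coord y := by
    intro r x
    induction r with
    | zero => exact ⟨x, Subgroup.mem_top _, rfl⟩
    | succ r ih =>
      obtain ⟨y, hy, hxy⟩ := ih
      refine ⟨MulAut.conjNormal g y * y⁻¹, ?_, ?_⟩
      · have h1 : ⁅(y : G), g⁆⁻¹ ∈ (⊤ : Subgroup G).lowerCentralSeries (r + 1) :=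
          inv_mem (Subgroup.commutator_mem_commutator hy (Subgroup.mem_top g))
        rw [commutatorElement_inv, commutatorElement_def] at h1
        simpa using h1
      · rw [pow_succ', Module.End.mul_apply, hxy, LinearMap.sub_apply, Module.End.one_apply,
          ContinuousLinearMap.coe_coe, conjMap_coord, B.coord_mul, B.coord_inv, sub_eq_add_neg]
  refine LinearMap.ext fun w => ?_
  obtain ⟨x, rfl⟩ := B.coord_surjective w
  obtain ⟨y, hy, hxy⟩ := key (Group.nilpotencyClass G) x
  rw [Subgroup.lowerCentralSeries_nilpotencyClass, Subgroup.mem_bot] at hy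
  rw [hxy, show y = 1 from Subtype.ext hy, B.coord_one]
  rfl

/-- `f` splits as a sequence in `N` with polynomial first-level coordinates times a sequence in
`Γ` acting polynomially on the first-level coordinates. -/
def HasPolyDecomposition (f : ℤ → G) : Prop :=
  ∃ (v : ℤ → N) (γ : ℤ → G), (∀ n, γ n ∈ Γ) ∧ (∀ n, f n = v n * γ n) ∧
    IsPolyFun (fun n => B.coord (v n)) ∧ ∀ w, IsPolyFun (fun n => conjMap B (γ n) w)

theorem HasPolyDecomposition.one : HasPolyDecomposition B (fun _ => 1) :=
  ⟨fun _ => 1, fun _ => 1, fun _ => one_mem _, fun _ => by simp, IsPolyFun.const _,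
    fun _ => IsPolyFun.const _⟩

-- `(v γ)(v' γ') = v (γ v' γ⁻¹) · γ γ'`; the conjugation by `γ` is why the decomposition also
-- records a polynomial action.
variable {B} in
theorem HasPolyDecomposition.mul {f f' : ℤ → G} (hf : HasPolyDecomposition B f)
    (hf' : HasPolyDecomposition B f') : HasPolyDecomposition B (fun n => f n * f' n) := by
  obtain ⟨v, γ, hγ, hvγ, hv, hT⟩ := hf
  obtain ⟨v', γ', hγ', hvγ', hv', hT'⟩ := hf'
  refine ⟨fun n => v n * MulAut.conjNormal (γ n) (v' n), fun n => γ n * γ' n,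
    fun n => mul_mem (hγ n) (hγ' n), fun n => ?_, ?_, fun w => ?_⟩
  · simp [hvγ, hvγ', mul_assoc]
  · simp only [B.coord_mul, ← conjMap_coord]
    exact hv.add (IsPolyFun.apply hT hv')
  · simp only [conjMap_mul]
    exact IsPolyFun.apply hT (hT' w)

/-- Put `c ^ m = u m * γ ^ m`. Then `u (m+1) = v · γ (u m) γ⁻¹`, so the coordinates of `u` follow a
unipotent affine recurrence; substitute `m = n choose i`. -/
theorem hasPolyDecomposition_zpow_choose {c : G} {v : N} {γ : G} (hγ : γ ∈ Γ)
    (hc : c = v * γ) (i : ℕ) : HasPolyDecomposition B (fun n => c ^ (Ring.choose n i : ℤ)) := by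
  have hmem : ∀ m : ℤ, c ^ m * γ ^ (-m) ∈ N := by
    intro m
    have h1 : (QuotientGroup.mk' N) c = (QuotientGroup.mk' N) γ := by
      rw [hc, map_mul, show QuotientGroup.mk' N (v : G) = 1 from
        (QuotientGroup.eq_one_iff _).2 v.2, one_mul]
    rw [← QuotientGroup.eq_one_iff]
    change QuotientGroup.mk' N _ = 1
    rw [map_mul, map_zpow, map_zpow, h1, ← zpow_add, add_neg_cancel, zpow_zero]
  let u : ℤ → N := fun m => ⟨c ^ m * γ ^ (-m), hmem m⟩
  have hu : ∀ m, u (m + 1) = v * MulAut.conjNormal γ (u m) := by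
    intro m
    refine Subtype.ext ?_
    simp only [u, Subgroup.coe_mul, MulAut.conjNormal_apply]
    rw [add_comm m 1, zpow_one_add, neg_add, add_comm (-1), zpow_add γ (-m) (-1), zpow_neg_one]
    nth_rewrite 1 [hc]
    group
  obtain ⟨q, hq⟩ := exists_polynomial_eval_eq_choose i
  refine ⟨fun n => u (Ring.choose n i), fun n => γ ^ (Ring.choose n i : ℤ),
    fun n => zpow_mem hγ _, fun n => ?_, ?_, fun w => ?_⟩
  · simp [u]
  · refine IsPolyFun.comp (f := fun m => B.coord (u m)) ?_ q hq
    refine isPolyFun_of_affine_recurrence _ (conjMap_unipotent B γ) (B.coord v) fun m => ?_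
    rw [hu, B.coord_mul, ContinuousLinearMap.coe_coe, conjMap_coord, add_comm]
  · refine IsPolyFun.comp (f := fun m => conjMap B (γ ^ m) w) ?_ q hq
    refine isPolyFun_of_affine_recurrence _ (conjMap_unipotent B γ) 0 fun m => ?_
    rw [add_comm m 1, zpow_one_add, conjMap_mul, add_zero, ContinuousLinearMap.coe_coe]

/-- Products of binomial powers have a polynomial decomposition. -/
theorem hasPolyDecomposition_prod (hNΓ : ∀ g : G, ∃ v : N, ∃ γ ∈ Γ, g = v * γ) (c : ℕ → G)
    (l : List ℕ) :
    HasPolyDecomposition B (fun n => (l.map fun i => c i ^ (Ring.choose n i : ℤ)).prod) := by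
  induction l with
  | nil => exact HasPolyDecomposition.one B
  | cons i l ih =>
    obtain ⟨v, γ, hγ, hc⟩ := hNΓ (c i)
    simpa using (hasPolyDecomposition_zpow_choose B hγ hc i).mul ih

end Nilmanifold

/-! ### From small spanning elements to the whole group -/

/-- An additive subgroup of a finite-dimensional space in which arbitrarily small elements span
is dense. -/
theorem AddSubgroup.dense_of_span_small_eq_top {V : Type*} [NormedAddCommGroup V]
    [NormedSpace ℝ V] [FiniteDimensional ℝ V] (D : AddSubgroup V)
    (h : ∀ ε > 0, Submodule.span ℝ {w | w ∈ D ∧ ‖w‖ < ε} = ⊤) : Dense (D : Set V) := by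
  rw [Metric.dense_iff]
  intro v ε hε
  -- The `+ 1` keeps `d` positive in dimension zero and the final estimate strict.
  let d : ℝ := Module.finrank ℝ V + 1
  have hd : 0 < d := by positivity
  let b := Module.Basis.ofSpan (h (ε / d) (by positivity)).ge
  have hb : ∀ i, b i ∈ D ∧ ‖b i‖ < ε / d := fun i =>
    Module.Basis.ofSpan_subset (h (ε / d) (by positivity)).ge (Set.mem_range_self i)
  let : Fintype _ := FiniteDimensional.fintypeBasisIndex b
  refine ⟨ZSpan.floor b v, ?_, ?_⟩
  · rw [Metric.mem_ball, dist_comm, dist_eq_norm]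
    change ‖ZSpan.fract b v‖ < ε
    calc ‖ZSpan.fract b v‖ ≤ ∑ i, ‖b i‖ := ZSpan.norm_fract_le b v
      _ ≤ ∑ _i, ε / d := Finset.sum_le_sum fun i _ => (hb i).2.le
      _ = Module.finrank ℝ V * (ε / d) := by
        rw [Finset.sum_const, nsmul_eq_mul, Finset.card_univ, Module.finrank_eq_card_basis b]
      _ < d * (ε / d) := mul_lt_mul_of_pos_right (lt_add_one _) (by positivity)
      _ = ε := mul_div_cancel₀ _ hd.ne'
  · have : Submodule.span ℤ (Set.range b) ≤ D.toIntSubmodule := by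
      rw [Submodule.span_le]
      rintro _ ⟨i, rfl⟩
      exact (hb i).1
    exact this (ZSpan.floor b v).2

theorem Set.Infinite.exists_infinite_fiber_of_mapsTo {α β : Type*} {S : Set α} (hS : S.Infinite)
    {f : α → β} {F : Set β} (hF : F.Finite) (hf : ∀ a ∈ S, f a ∈ F) :
    ∃ c, {a | a ∈ S ∧ f a = c}.Infinite := by
  by_contra! h
  refine hS ((hF.biUnion fun c _ => h c).subset fun a ha => ?_)
  exact Set.mem_biUnion (hf a ha) ⟨ha, rfl⟩

section Nilmanifold

variable {G : Type*} [Group G] [TopologicalSpace G] [IsTopologicalGroup G] [Group.IsNilpotent G]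
  {N : Subgroup G} [N.Normal] [T2Space N] [LocallyCompactSpace N] {Γ : Subgroup G}
  (B : MalcevBasis N (Γ.subgroupOf N))

open Topology in
/-- A closed subgroup containing infinitely many fractional parts has, near the identity, enough
elements to span the first-level coordinates. -/
theorem span_coord_eq_top (hNopen : IsOpen (N : Set G)) {g : ℤ → G}
    (hdense : Dense (Set.range (fun n : ℕ => (QuotientGroup.mk (g (n : ℤ)) : G ⧸ Γ))))
    (hg : HasPolyDecomposition B g) (H : Subgroup N) (hH : IsClosed (H : Set N)) {S : Set ℤ}
    (hS : S.Infinite)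
    (hSH : ∀ n ∈ S, ∃ x ∈ H, x ∈ B.fundamentalDomain ∧ ∃ γ ∈ Γ, g n = x * γ)
    {U : Set N} (hU : U ∈ 𝓝 1) :
    Submodule.span ℝ (B.coord '' {x | x ∈ H ∧ x ∈ U}) = ⊤ := by
  classical
  by_contra hne
  obtain ⟨L, hL0, hL⟩ := Submodule.exists_le_ker_of_lt_top _ (lt_top_iff_ne_top.2 hne)
  obtain ⟨v, γ, hγ, hgv, ⟨p, hp⟩, -⟩ := hg
  obtain ⟨K, hK, hDK⟩ := B.exists_isCompact_fundamentalDomain_subset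
  choose! x hxH hxD γ' hγ' hgx using hSH
  have hLU : ∀ y ∈ H, y ∈ U → L (B.coord y) = 0 := fun y hy hyU =>
    hL (Submodule.subset_span ⟨y, ⟨hy, hyU⟩, rfl⟩)
  -- Elements of `H` differing by an element of `U` have equal `L ∘ coord`; finitely many translates
  -- of `U` cover `K ∩ H`.
  have hfin : ((fun y => L (B.coord y)) '' (K ∩ H)).Finite := by
    obtain ⟨t, ht, htK⟩ := (hK.inter_right hH).elim_nhds_subcover (fun y => (y⁻¹ * ·) ⁻¹' U)
      (fun y _ => ContinuousAt.preimage_mem_nhds (by fun_prop) (by simpa using hU))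
    refine (t.finite_toSet.image fun y => L (B.coord y)).subset ?_
    rintro _ ⟨y, hy, rfl⟩
    obtain ⟨z, hz, hyz⟩ := Set.mem_iUnion₂.1 (htK hy)
    refine ⟨z, hz, ?_⟩
    have := hLU (z⁻¹ * y) (mul_mem (inv_mem (ht z hz).2) hy.2) hyz
    rw [B.coord_mul, B.coord_inv, map_add, map_neg] at this
    exact (neg_add_eq_zero.1 this)
  obtain ⟨c, hc⟩ := hS.exists_infinite_fiber_of_mapsTo (f := fun n => L (B.coord (x n))) hfin
    fun n hn => ⟨x n, ⟨hDK (hxD n hn), hxH n hn⟩, rfl⟩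
  obtain ⟨M, hM⟩ := (hK.image B.continuous_coord).isBounded.exists_norm_le
  have hint : ∀ n ∈ S, ∃ m : B.FirstLevel → ℤ, ∀ i, B.coord (v n) i - m i = B.coord (x n) i := by
    intro n hn
    have h1 : ((x n)⁻¹ * v n : N) ∈ Γ.subgroupOf N := by
      rw [Subgroup.mem_subgroupOf]
      have h2 : ((x n : G))⁻¹ * v n = γ' n * (γ n)⁻¹ := by
        rw [eq_mul_inv_iff_mul_eq, mul_assoc, ← hgv n, hgx n hn, inv_mul_cancel_left]
      simpa [h2] using mul_mem (hγ' n hn) (inv_mem (hγ n))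
    obtain ⟨m, hm⟩ := B.exists_int_coord h1
    refine ⟨m, fun i => ?_⟩
    have := congrFun hm i
    rw [B.coord_mul, B.coord_inv, Pi.add_apply, Pi.neg_apply] at this
    linarith
  choose! m hm using hint
  have hLsum : ∀ w : B.FirstLevel → ℝ, L w = ∑ i, L (Pi.single i 1) * w i := by
    intro w
    conv_lhs => rw [pi_eq_sum_univ' w]
    simp only [map_sum, map_smul, smul_eq_mul, mul_comm]
  obtain ⟨q, hq, c', hc'⟩ := exists_int_relation_of_affine_relation p hc m (M := M)
    (fun n hn i => by
      rw [← hp, hm n hn.1, ← Real.norm_eq_abs]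
      exact (norm_le_pi_norm _ i).trans (hM _ ⟨x n, hDK (hxD n hn.1), rfl⟩))
    (fun i => L (Pi.single i 1))
    (fun h => hL0 (LinearMap.ext fun w => by
      rw [hLsum]
      exact Finset.sum_eq_zero fun i _ => by
        rw [show L (Pi.single i 1) = 0 from congrFun h i, zero_mul]))
    c (fun n hn => by
      simp only [← hp, hm n hn.1, ← hLsum]
      exact hn.2)
  exact not_int_relation_of_dense B hNopen hdense hγ hgv q hq c' (by simpa only [hp] using hc')

open Topology in
/-- A closed subgroup containing infinitely many fractional parts of a dense sequence with
polynomial decomposition is everything. -/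
theorem eq_top_of_infinite_fractionalPart (hNopen : IsOpen (N : Set G)) {g : ℤ → G}
    (hdense : Dense (Set.range (fun n : ℕ => (QuotientGroup.mk (g (n : ℤ)) : G ⧸ Γ))))
    (hg : HasPolyDecomposition B g) (H : Subgroup N) (hH : IsClosed (H : Set N)) {S : Set ℤ}
    (hS : S.Infinite)
    (hSH : ∀ n ∈ S, ∃ x ∈ H, x ∈ B.fundamentalDomain ∧ ∃ γ ∈ Γ, g n = x * γ) : H = ⊤ := by
  refine eq_top_of_isClosed_of_dense_mul_commutator H hH ?_
  let D : AddSubgroup (B.FirstLevel → ℝ) := Subgroup.toAddSubgroup' (H.map B.coordHom)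
  have hD : ∀ w, w ∈ D ↔ ∃ h ∈ H, B.coord h = w := fun w => Iff.rfl
  have hDdense : Dense (D : Set (B.FirstLevel → ℝ)) := by
    refine D.dense_of_span_small_eq_top fun ε hε => ?_
    have hU : {y : N | ‖B.coord y‖ < ε} ∈ 𝓝 (1 : N) :=
      (isOpen_lt (by have := B.continuous_coord; fun_prop) continuous_const).mem_nhds
        (by simpa [B.coord_one] using hε)
    rw [eq_top_iff, ← span_coord_eq_top B hNopen hdense hg H hH hS hSH hU]
    refine Submodule.span_mono ?_
    rintro _ ⟨y, ⟨hy, hyU⟩, rfl⟩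
    exact ⟨(hD _).2 ⟨y, hy, rfl⟩, hyU⟩
  intro x
  -- This map sends `coord x` to `x` and `D` into `H [N, N]`, so density of `D` puts `x` in the
  -- closure.
  have hcont : Continuous fun w => B.firstLevelProd w * ((B.firstLevelProd (B.coord x))⁻¹ * x) :=
    B.continuous_firstLevelProd.mul continuous_const
  have hx := image_closure_subset_closure_image hcont (s := (D : Set (B.FirstLevel → ℝ)))
    ⟨B.coord x, hDdense _, mul_inv_cancel_left _ _⟩
  refine closure_mono ?_ hx
  rintro _ ⟨w, hw, rfl⟩
  obtain ⟨h, hh, rfl⟩ := (hD w).1 hw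
  have h1 : ∀ y : N, y⁻¹ * B.firstLevelProd (B.coord y) ∈ commutator N := fun y => by
    rw [← abelianization_of_eq_iff, B.of_firstLevelProd_coord]
  have h2 : (B.firstLevelProd (B.coord x))⁻¹ * x ∈ commutator N := by
    simpa using inv_mem (h1 x)
  have h3 : B.firstLevelProd (B.coord h) ∈ H ⊔ commutator N := by
    rw [← mul_inv_cancel_left h (B.firstLevelProd (B.coord h))]
    exact mul_mem (Subgroup.mem_sup_left hh) (Subgroup.mem_sup_right (h1 h))
  exact mul_mem h3 (Subgroup.mem_sup_right h2)

end Nilmanifold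

/-! ### The identity component and the conclusion -/

/-- If `G / Γ` is connected, then `Γ` meets every coset of an open normal subgroup. -/
theorem exists_eq_mul_of_connectedSpace_quotient {G : Type*} [Group G] [TopologicalSpace G]
    [IsTopologicalGroup G] {N Γ : Subgroup G} [N.Normal] (hN : IsOpen (N : Set G))
    [ConnectedSpace (G ⧸ Γ)] (g : G) : ∃ v : N, ∃ γ ∈ Γ, g = v * γ := by
  -- An open subgroup is closed, and `N Γ` is `Γ`-saturated, so its image in the connected quotient
  -- is clopen.
  have hopen : IsOpen ((N ⊔ Γ : Subgroup G) : Set G) := Subgroup.isOpen_mono le_sup_left hN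
  have hsat : (QuotientGroup.mk : G → G ⧸ Γ) ⁻¹'
      ((QuotientGroup.mk : G → G ⧸ Γ) '' ((N ⊔ Γ : Subgroup G) : Set G)) =
      ((N ⊔ Γ : Subgroup G) : Set G) := by
    refine Set.Subset.antisymm ?_ (Set.subset_preimage_image _ _)
    rintro x ⟨y, hy, hxy⟩
    have := mul_mem hy (Subgroup.mem_sup_right (QuotientGroup.eq.1 hxy) : y⁻¹ * x ∈ N ⊔ Γ)
    simpa using this
  have hclopen : IsClopen ((QuotientGroup.mk : G → G ⧸ Γ) '' ((N ⊔ Γ : Subgroup G) : Set G)) := by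
    refine ⟨?_, QuotientGroup.isOpenMap_coe _ hopen⟩
    rw [← (QuotientGroup.isQuotientMap_mk (N := Γ)).isClosed_preimage, hsat]
    exact Subgroup.isClosed_of_isOpen _ hopen
  have huniv := hclopen.eq_univ ⟨_, Set.mem_image_of_mem _ (one_mem _)⟩
  have hg : g ∈ N ⊔ Γ := by
    rw [← SetLike.mem_coe, ← hsat, huniv]
    trivial
  rw [← SetLike.mem_coe, Subgroup.normal_mul] at hg
  obtain ⟨v, hv, γ, hγ, rfl⟩ := hg
  exact ⟨⟨v, hv⟩, γ, hγ, rfl⟩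

/-- The identity component of a topological group is normal. -/
instance Subgroup.normal_connectedComponentOfOne (G : Type*) [Group G] [TopologicalSpace G]
    [IsTopologicalGroup G] : (Subgroup.connectedComponentOfOne G).Normal := by
  refine ⟨fun x hx g => ?_⟩
  have h : Continuous fun y : G => g * y * g⁻¹ := by fun_prop
  have hgx : g * x * g⁻¹ ∈ connectedComponent (1 : G) := by
    simpa using h.image_connectedComponent_subset 1 ⟨x, hx, rfl⟩
  exact hgx

theorem mainTheorem10
    {E : Type*} [NormedAddCommGroup E] [NormedSpace ℝ E] [FiniteDimensional ℝ E]
    -- a nilpotent Lie group with simply connected identity component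
    {G : Type*} [Group G] [TopologicalSpace G] [IsTopologicalGroup G]
    [ChartedSpace E G] [LieGroup 𝓘(ℝ, E) ∞ G] [Group.IsNilpotent G]
    [SimplyConnectedSpace (Subgroup.connectedComponentOfOne G)]
    -- a discrete cocompact subgroup with all `G_i / Γ_i` connected
    (Γ : Subgroup G) [DiscreteTopology Γ] [CompactSpace (G ⧸ Γ)] [ConnectedSpace (G ⧸ Γ)]
    (hconn : ∀ i : ℕ,
      ConnectedSpace (↥(lowerCentral G i) ⧸ Γ.subgroupOf (lowerCentral G i)))
    -- a Mal'cev basis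
    (B : MalcevBasis (Subgroup.connectedComponentOfOne G)
      (Γ.subgroupOf (Subgroup.connectedComponentOfOne G)))
    -- a polynomial sequence with dense image in `G / Γ`
    (g : ℤ → G) (hg : IsPolynomialSequence g)
    (hdense : Dense (Set.range (fun n : ℕ => (QuotientGroup.mk (g (n : ℤ)) : G ⧸ Γ))))
    -- a closed (that is, embedded Lie) subgroup of the identity component
    (H : Subgroup G) (hH : H ≤ Subgroup.connectedComponentOfOne G)
    (hHclosed : IsClosed (H : Set G))
    (hinf : {n : ℤ | ∃ x ∈ H, IsFractionalPart B (g n) x}.Infinite) :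
    H = Subgroup.connectedComponentOfOne G := by
  have : LocallyCompactSpace G := ChartedSpace.locallyCompactSpace E G
  have : LocallyConnectedSpace G := ChartedSpace.locallyConnectedSpace E G
  have : T1Space G := ChartedSpace.t1Space E G
  have hNopen : IsOpen (Subgroup.connectedComponentOfOne G : Set G) := isOpen_connectedComponent
  have hNclosed : IsClosed (Subgroup.connectedComponentOfOne G : Set G) :=
    isClosed_connectedComponent
  have : LocallyCompactSpace (Subgroup.connectedComponentOfOne G) :=
    hNclosed.isClosedEmbedding_subtypeVal.locallyCompactSpace
  obtain ⟨c, -, hgc⟩ := hg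
  have hdec : HasPolyDecomposition B g := by
    rw [show g = _ from funext hgc]
    exact hasPolyDecomposition_prod B (exists_eq_mul_of_connectedSpace_quotient hNopen) c _
  have htop := eq_top_of_infinite_fractionalPart B hNopen hdense hdec
    (H.subgroupOf (Subgroup.connectedComponentOfOne G))
    (hHclosed.preimage continuous_subtype_val) hinf (by
      rintro n ⟨x, hxH, ⟨y, hy, rfl⟩, γ, hγ, hgn⟩
      exact ⟨y, Subgroup.mem_subgroupOf.2 hxH, hy, γ, hγ, hgn⟩)
  exact le_antisymm hH (Subgroup.subgroupOf_eq_top.1 htop)
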